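/- Let $\mathrm{Nil}_3$ be the Heisenberg group, i.e. $\mathbb{R}^3$ with the group operation $$(x,y,z)*(\bar x,\bar y,\bar z)=\Big(x+\bar x,\ y+\bar y,\ z+\bar z+\tfrac{x\bar y}{2}-\tfrac{\bar x y}{2}\Big)$$ and the left-invariant Riemannian metric $\tilde g=dx^2+dy^2+\big(dz+\tfrac12(y\,dx-x\,dy)\big)^2$. Let $I,J\subseteq\mathbb{R}$ be non-empty open intervals, let $u:I\to\mathbb{R}$ and $v:J\to\mathbb{R}$ be smooth ($C^\infty$) functions, and consider the translation surface of type 6, parametrized on $I\times J$ by $$r(x,y)=(y,v(y),0)*(0,x,u(x))=\Big(y,\ x+v(y),\ u(x)+\frac{xy}{2}\Big).$$ Then $r$ is a minimal surface in $(\mathrm{Nil}_3,\tilde g)$ (an immersion whose mean curvature vanishes identically) if and only if one of the following holds: (i) there are $u_0,a,b\in\mathbb{R}$, with $a=0$ in case $0\in J$, such that $u(x)=u_0$ for all $x\in I$ and $v(y)=\frac ay+b$ for all $y\in J$ (for $a=0$ this means $v(y)=b$); (ii) there are $a,b,c,c_1\in\mathbb{R}$ such that $v(y)=ay+b$ for all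 $y\in J$ and $$u(x)=\frac{ax^2+abx+c}{2(1+a^2)}+c_1\Big(\frac x2+\frac b4\Big)\sqrt{4(1+a^2)+(2x+b)^2}+c_1(1+a^2)\ln\Big(2x+b+\sqrt{4(1+a^2)+(2x+b)^2}\Big)$$ for all $x\in I$. -/

import Mathlib

open Set
open scoped ContDiff

/-- The underlying manifold `ℝ³` of the Heisenberg group, in its global coordinates. -/
abbrev Nil3 : Type := Fin 3 → ℝ

namespace Nil3

/-- The group operation of the Heisenberg group. -/
noncomputable def mul (p q : Nil3) : Nil3 :=
  ![p 0 + q 0, p 1 + q 1, p 2 + q 2 + p 0 * q 1 / 2 - q 0 * p 1 / 2]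

/-- The one-form `dz + (y dx - x dy) / 2` at the point `p`, applied to a tangent vector `X`. -/
noncomputable def contactForm (p X : Nil3) : ℝ :=
  X 2 + (p 1 * X 0 - p 0 * X 1) / 2

/-- The left-invariant metric `dx² + dy² + (dz + (y dx - x dy) / 2)²` at the point `p`. -/
noncomputable def metric (p X Y : Nil3) : ℝ :=
  X 0 * Y 0 + X 1 * Y 1 + contactForm p X * contactForm p Y

/-- The coordinate matrix `(g_ij)` of the metric at `p`. -/
noncomputable def metricMatrix (p : Nil3) : Matrix (Fin 3) (Fin 3) ℝ :=
  Matrix.of fun i j => metric p (Pi.single i 1) (Pi.single j 1)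

/-- The partial derivative `∂_l g_ij` at `p`. -/
noncomputable def dMetric (p : Nil3) (l i j : Fin 3) : ℝ :=
  fderiv ℝ (fun p' : Nil3 => metricMatrix p' i j) p (Pi.single l 1)

/-- The Christoffel symbols `Γ^k_ij` of the Levi-Civita connection of the metric. -/
noncomputable def christoffel (p : Nil3) (k i j : Fin 3) : ℝ :=
  (1 / 2) * ∑ l, (metricMatrix p)⁻¹ k l * (dMetric p i j l + dMetric p j i l - dMetric p l i j)

/-- The two coordinate directions of the parameter plane. -/
def direction : Fin 2 → ℝ × ℝ := ![(1, 0), (0, 1)]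

/-- The coordinate tangent vector fields `r_x` (index `0`) and `r_y` (index `1`) of a
parametrized surface `r`. -/
noncomputable def tangent (r : ℝ × ℝ → Nil3) (a : Fin 2) (q : ℝ × ℝ) : Nil3 :=
  fderiv ℝ r q (direction a)

/-- The Levi-Civita covariant derivative of the field `r_b` along the surface `r`, in the
direction `r_a`. -/
noncomputable def covDeriv (r : ℝ × ℝ → Nil3) (a b : Fin 2) (q : ℝ × ℝ) : Nil3 := fun k =>
  fderiv ℝ (tangent r b) q (direction a) k +
    ∑ i, ∑ j, christoffel (r q) k i j * tangent r a q i * tangent r b q j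

/-- The matrix of the first fundamental form in the basis `r_x, r_y`. -/
noncomputable def firstForm (r : ℝ × ℝ → Nil3) (q : ℝ × ℝ) : Matrix (Fin 2) (Fin 2) ℝ :=
  Matrix.of fun a b => metric (r q) (tangent r a q) (tangent r b q)

/-- The matrix of the second fundamental form with respect to a normal vector `N` at `r q`. -/
noncomputable def secondForm (r : ℝ × ℝ → Nil3) (q : ℝ × ℝ) (N : Nil3) :
    Matrix (Fin 2) (Fin 2) ℝ :=
  Matrix.of fun a b => metric (r q) (covDeriv r a b q) N

/-- `N` is a unit normal vector of the surface `r` at the parameter `q`. -/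
def IsUnitNormal (r : ℝ × ℝ → Nil3) (q : ℝ × ℝ) (N : Nil3) : Prop :=
  metric (r q) N N = 1 ∧ ∀ a, metric (r q) (tangent r a q) N = 0

/-- The mean curvature, half the trace of the shape operator, with respect to the unit
normal `N`. -/
noncomputable def meanCurvature (r : ℝ × ℝ → Nil3) (q : ℝ × ℝ) (N : Nil3) : ℝ :=
  (1 / 2) * ((firstForm r q)⁻¹ * secondForm r q N).trace

/-- `r` restricted to the parameter domain `U` is a minimal surface: a smooth immersion whose
mean curvature vanishes identically (for either choice of the unit normal). -/
def IsMinimal (r : ℝ × ℝ → Nil3) (U : Set (ℝ × ℝ)) : Prop :=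
  ContDiffOn ℝ ∞ r U ∧
  ∀ q ∈ U, LinearIndependent ℝ (fun a => tangent r a q) ∧
    ∀ N, IsUnitNormal r q N → meanCurvature r q N = 0

/-- The translation surface of type 6: `r (x, y) = (y, v y, 0) * (0, x, u x)`. -/
noncomputable def type6Surface (u v : ℝ → ℝ) (q : ℝ × ℝ) : Nil3 :=
  mul ![q.2, v q.2, 0] ![0, q.1, u q.1]

end Nil3

/-!
In the left-invariant frame the metric is Euclidean and the Christoffel symbols enter only through
the derivative of the contact form, so minimality of `r` becomes an equation
`minimalOperator u v x y = 0` in `u'`, `u''`, `v`, `v'` and `v''`.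

Suppose `v''` vanishes nowhere on some interval. Differentiating in `y`, dividing by `v''` and
differentiating twice more leaves `α * u'' = (1 + u' ^ 2) * (β * u' + γ)` with `α`, `β`, `γ`
depending only on `y`. If `α` vanishes identically and `u'` is not constant, then so do `β` and
`γ`, which contradicts the form of `α`. At a point where `α ≠ 0`, the second `y`-derivative gives
`(x - B) * u''` as a polynomial in `u'` too, and eliminating `x` shows that `u'` is a root of a
nontrivial polynomial. Hence `u'' = 0`; the `x`-derivative of the equation then gives `u' = 0`,
and what remains says that `y ^ 2 * v'` is constant. If on the other hand `v y = a * y + b`, the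
equation is a first-order linear one for `u'`, with homogeneous solution
`√(4 * (1 + a ^ 2) + (2 * x + b) ^ 2)`.
-/

section Calculus

open Polynomial Topology

variable {𝕜 : Type*} [NontriviallyNormedField 𝕜]

lemma hasDerivAt_unique_of_eqOn {F : Type*} [NormedAddCommGroup F] [NormedSpace 𝕜 F]
    {f g : 𝕜 → F} {f' g' : F} {s : Set 𝕜} {x : 𝕜} (hs : IsOpen s) (hx : x ∈ s)
    (hfg : EqOn f g s) (hf : HasDerivAt f f' x) (hg : HasDerivAt g g' x) : f' = g' :=
  hf.unique (hg.congr_of_eventuallyEq (hfg.eventuallyEq_of_mem (hs.mem_nhds hx)))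

lemma eq_zero_of_eventually_eval_eq_zero {P : 𝕜[X]} {p : 𝕜 → 𝕜} {p' x : 𝕜}
    (hp : HasDerivAt p p' x) (hp' : p' ≠ 0) (hP : ∀ᶠ t in 𝓝 x, P.eval (p t) = 0) : P = 0 := by
  by_contra hne
  have hroots : ∀ᶠ t in 𝓝[≠] x, ∀ z ∈ {z | P.IsRoot z}, p t ≠ z :=
    (Filter.eventually_all_finite (Polynomial.finite_setOfPred_isRoot hne)).2 fun z _ =>
      hp.eventually_ne hp'
  obtain ⟨t, ht, hPt⟩ := (hroots.and (hP.filter_mono nhdsWithin_le_nhds)).exists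
  exact ht _ hPt rfl

lemma hasDerivAt_const_div {a y : 𝕜} (hay : a = 0 ∨ y ≠ 0) :
    HasDerivAt (fun y => a / y) (-a / y ^ 2) y := by
  rcases hay with rfl | hy
  · simpa using hasDerivAt_const y (0 : 𝕜)
  · simpa using (hasDerivAt_const y a).fun_div (hasDerivAt_id' y) hy

lemma exists_eq_add_of_hasDerivAt {F : Type*} [NormedAddCommGroup F] [NormedSpace ℝ F]
    {f g f' : ℝ → F} {s : Set ℝ} (hs : IsOpen s) (hsc : s.OrdConnected)
    (hf : ∀ x ∈ s, HasDerivAt f (f' x) x) (hg : ∀ x ∈ s, HasDerivAt g (f' x) x) :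
    ∃ c, ∀ x ∈ s, f x = g x + c :=
  hs.exists_eq_add_of_deriv_eq hsc.isPreconnected
    (fun x hx => (hf x hx).differentiableAt.differentiableWithinAt)
    (fun x hx => (hg x hx).differentiableAt.differentiableWithinAt)
    fun x hx => (hf x hx).deriv.trans (hg x hx).deriv.symm

lemma exists_eq_const_mul_of_wronskian_eq_zero {f g f' g' : ℝ → ℝ} {s : Set ℝ} (hs : IsOpen s)
    (hsc : s.OrdConnected) (hf : ∀ x ∈ s, HasDerivAt f (f' x) x)
    (hg : ∀ x ∈ s, HasDerivAt g (g' x) x) (hg₀ : ∀ x ∈ s, g x ≠ 0)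
    (hfg : ∀ x ∈ s, f' x * g x = f x * g' x) : ∃ c, ∀ x ∈ s, f x = c * g x := by
  have hquot (x) (hx : x ∈ s) : HasDerivAt (fun x => f x / g x) 0 x :=
    ((hf x hx).fun_div (hg x hx) (hg₀ x hx)).congr_deriv (by rw [hfg x hx, sub_self, zero_div])
  obtain ⟨c, hc⟩ := exists_eq_add_of_hasDerivAt hs hsc hquot fun x _ => hasDerivAt_const x 0
  exact ⟨c, fun x hx => (div_eq_iff (hg₀ x hx)).1 ((hc x hx).trans (zero_add c))⟩

lemma hasDerivAt_sqrt_add_sq {k : ℝ} (hk : 0 < k) (s : ℝ) :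
    HasDerivAt (fun s => √(k + s ^ 2)) (s / √(k + s ^ 2)) s := by
  refine (((hasDerivAt_pow 2 s).const_add k).sqrt (by positivity)).congr_deriv ?_
  rw [pow_one, Nat.cast_ofNat, mul_div_mul_left _ _ two_ne_zero]

lemma add_sqrt_add_sq_pos {k : ℝ} (hk : 0 < k) (s : ℝ) : 0 < s + √(k + s ^ 2) := by
  have habs : |s| < √(k + s ^ 2) := Real.lt_sqrt_of_sq_lt (by rw [sq_abs]; linarith)
  linarith [(abs_lt.1 habs).1]

lemma hasDerivAt_mul_sqrt_add_log {k : ℝ} (hk : 0 < k) (s : ℝ) :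
    HasDerivAt (fun s => s * √(k + s ^ 2) + k * Real.log (s + √(k + s ^ 2)))
      (2 * √(k + s ^ 2)) s := by
  have hsqrt := hasDerivAt_sqrt_add_sq hk s
  have hlog := ((hasDerivAt_id' s).fun_add hsqrt).log (add_sqrt_add_sq_pos hk s).ne'
  refine (((hasDerivAt_id' s).fun_mul hsqrt).add (hlog.const_mul k)).congr_deriv ?_
  have hR : √(k + s ^ 2) ≠ 0 := (Real.sqrt_pos.2 (by positivity)).ne'
  have hR_sq : √(k + s ^ 2) ^ 2 = k + s ^ 2 := Real.sq_sqrt (by positivity)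
  have hlog' : (1 + s / √(k + s ^ 2)) / (s + √(k + s ^ 2)) = 1 / √(k + s ^ 2) := by
    have := add_sqrt_add_sq_pos hk s
    field_simp
    ring
  rw [hlog']
  field_simp
  linear_combination -hR_sq

/- Differentiating the second equation and eliminating `t - B` and `deriv p` with the two given
equations leaves a polynomial relation for `p`. -/
lemma eventually_eliminant_eq_zero {p : ℝ → ℝ} {x κ l B m n : ℝ} (hx : deriv p x ≠ 0)
    (h₁ : ∀ᶠ t in 𝓝 x, deriv p t = (1 + p t ^ 2) * (κ * p t + l))
    (h₂ : ∀ᶠ t in 𝓝 x, (t - B) * deriv p t = p t / 2 - (1 + p t ^ 2) * (m * p t + n)) :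
    ∀ᶠ t in 𝓝 x, (l * m - κ * n) * (1 + p t ^ 2) ^ 2 +
      (1 + p t ^ 2) * (2 * κ * p t + l) / 2 + p t ^ 2 * (κ * p t + l) = 0 := by
  have hcont : ContinuousAt (deriv p) x := by
    have hp := (differentiableAt_of_deriv_ne_zero hx).continuousAt
    exact ContinuousAt.congr (by fun_prop) (h₁.mono fun _ => Eq.symm)
  filter_upwards [hcont.eventually_ne hx, h₁.eventually_nhds, h₂.eventually_nhds] with t ht h₁ h₂
  have hp := (differentiableAt_of_deriv_ne_zero ht).hasDerivAt
  have hsq := (hp.fun_pow 2).const_add 1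
  have hp' := (hsq.fun_mul ((hp.const_mul κ).add_const l)).congr_of_eventuallyEq h₁
  have hderiv := ((((hasDerivAt_id' t).sub_const B).fun_mul hp').congr_of_eventuallyEq
    (h₂.mono fun _ => Eq.symm)).unique ((hp.div_const 2).fun_sub
      (hsq.fun_mul ((hp.const_mul m).add_const n)))
  have h₁ := h₁.self_of_nhds
  have h₂ := h₂.self_of_nhds
  simp only [Nat.cast_ofNat, Nat.add_one_sub_one, pow_one] at hderiv
  linear_combination hderiv - (1 / 2 + 2 * p t * (m * p t + n) + (1 + p t ^ 2) * m) * h₁ -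
    (κ * (1 + p t ^ 2) + 2 * p t * (κ * p t + l)) * h₂

lemma deriv_eq_zero_of_two_odes {p : ℝ → ℝ} {x κ l B m n : ℝ}
    (h₁ : ∀ᶠ t in 𝓝 x, deriv p t = (1 + p t ^ 2) * (κ * p t + l))
    (h₂ : ∀ᶠ t in 𝓝 x, (t - B) * deriv p t = p t / 2 - (1 + p t ^ 2) * (m * p t + n)) :
    deriv p x = 0 := by
  by_contra hx
  let P : ℝ[X] := C (l * m - κ * n) * (1 + X ^ 2) ^ 2 +
    (1 + X ^ 2) * (C (2 * κ) * X + C l) * C 2⁻¹ + X ^ 2 * (C κ * X + C l)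
  have hP : P = 0 := eq_zero_of_eventually_eval_eq_zero
    (differentiableAt_of_deriv_ne_zero hx).hasDerivAt hx
    ((eventually_eliminant_eq_zero hx h₁ h₂).mono fun t ht => by
      simpa [P, ← div_eq_mul_inv] using ht)
  have heval (z : ℝ) : (l * m - κ * n) * (1 + z ^ 2) ^ 2 +
      (1 + z ^ 2) * (2 * κ * z + l) / 2 + z ^ 2 * (κ * z + l) = 0 := by
    simpa [P, ← div_eq_mul_inv] using congrArg (eval z) hP
  have hκ : κ = 0 := by linarith [heval 1, heval (-1)]
  have hl : l = 0 := by linarith [heval 0, heval 1, heval 2]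
  exact hx (h₁.self_of_nhds.trans (by rw [hκ, hl]; ring))

end Calculus

namespace Nil3

open Matrix Topology

/-- The coordinates of a tangent vector at `p` in the left-invariant orthonormal frame
`∂x - (y / 2) ∂z`, `∂y + (x / 2) ∂z`, `∂z`. -/
noncomputable def frameCoord (p : Nil3) : Nil3 ≃ₗ[ℝ] (Fin 3 → ℝ) where
  toFun X := ![X 0, X 1, contactForm p X]
  invFun c := ![c 0, c 1, c 2 - (p 1 * c 0 - p 0 * c 1) / 2]
  map_add' X Y := by
    ext i; fin_cases i <;> simp [contactForm]; ring
  map_smul' t X := by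
    ext i; fin_cases i <;> simp [contactForm]; ring
  left_inv X := by
    ext i; fin_cases i <;> simp [contactForm]
  right_inv c := by
    ext i; fin_cases i <;> simp [contactForm]

lemma frameCoord_apply (p X : Nil3) : frameCoord p X = ![X 0, X 1, contactForm p X] := rfl

lemma metric_eq_dotProduct (p X Y : Nil3) :
    metric p X Y = frameCoord p X ⬝ᵥ frameCoord p Y := by
  simp [metric, frameCoord_apply, add_assoc]

lemma metric_smul_right (p X Y : Nil3) (t : ℝ) : metric p X (t • Y) = t * metric p X Y := by
  simp only [metric_eq_dotProduct, map_smul, dotProduct_smul, smul_eq_mul]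

lemma metric_smul_left (p X Y : Nil3) (t : ℝ) : metric p (t • X) Y = t * metric p X Y := by
  simp only [metric_eq_dotProduct, map_smul, smul_dotProduct, smul_eq_mul]

lemma metric_add_left (p X Y Z : Nil3) : metric p (X + Y) Z = metric p X Z + metric p Y Z := by
  simp only [metric_eq_dotProduct, map_add, add_dotProduct]

/-- The derivative of `p ↦ contactForm p Y` in the direction `X`; it does not depend on `p`. -/
noncomputable def dContactForm (X Y : Nil3) : ℝ := (X 1 * Y 0 - X 0 * Y 1) / 2

lemma hasFDerivAt_contactForm (p Y : Nil3) :
    HasFDerivAt (fun p => contactForm p Y)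
      ((2⁻¹ : ℝ) • (Y 0 • ContinuousLinearMap.proj (R := ℝ) (φ := fun _ : Fin 3 => ℝ) 1 -
        Y 1 • ContinuousLinearMap.proj 0)) p := by
  have hcoord (i : Fin 3) := hasFDerivAt_apply (𝕜 := ℝ) i p
  refine ((((hcoord 1).mul_const (Y 0)).sub ((hcoord 0).mul_const (Y 1))).const_smul
    (2⁻¹ : ℝ)).const_add (Y 2) |>.congr_of_eventuallyEq (.of_forall fun p => ?_)
  simp only [contactForm, Pi.smul_apply, Pi.sub_apply, smul_eq_mul]
  ring

lemma dMetric_eq (p : Nil3) (l i j : Fin 3) :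
    dMetric p l i j =
      dContactForm (Pi.single l 1) (Pi.single i 1) * contactForm p (Pi.single j 1) +
        contactForm p (Pi.single i 1) * dContactForm (Pi.single l 1) (Pi.single j 1) := by
  have h := ((hasFDerivAt_contactForm p (Pi.single i 1)).mul
    (hasFDerivAt_contactForm p (Pi.single j 1))).const_add
      ((Pi.single i 1 : Nil3) 0 * (Pi.single j 1 : Nil3) 0 +
        (Pi.single i 1 : Nil3) 1 * (Pi.single j 1 : Nil3) 1)
  refine (congrArg (· (Pi.single l 1)) h.fderiv).trans ?_
  simp only [dContactForm, _root_.add_apply, _root_.smul_apply, _root_.sub_apply,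
    ContinuousLinearMap.proj_apply, smul_eq_mul]
  ring

lemma det_metricMatrix (p : Nil3) : (metricMatrix p).det = 1 := by
  simp only [det_fin_three, metricMatrix, of_apply, metric, contactForm, Pi.single_eq_same, ne_eq,
    not_false_eq_true, Pi.single_eq_of_ne, Fin.reduceEq, one_ne_zero, zero_ne_one]
  ring

lemma metric_eq_dotProduct_mulVec (p X Y : Nil3) :
    metric p X Y = Y ⬝ᵥ metricMatrix p *ᵥ X := by
  simp only [metric, metricMatrix, of_apply, contactForm, dotProduct, mulVec, Fin.sum_univ_three,
    Pi.single_eq_same, ne_eq, not_false_eq_true, Pi.single_eq_of_ne, Fin.reduceEq, one_ne_zero,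
    zero_ne_one]
  ring

/-- Koszul's formula: lowering the index of `∑ Γ^k_ij X^i Y^j` leaves three derivatives of the
metric, and the derivatives of the contact form in the direction `Z` cancel. -/
lemma metric_christoffel (p X Y Z : Nil3) :
    metric p (fun k => ∑ i, ∑ j, christoffel p k i j * X i * Y j) Z =
      contactForm p Y * dContactForm X Z + contactForm p X * dContactForm Y Z := by
  set K : Nil3 := fun l => (1 / 2) * ∑ i, ∑ j,
    (dMetric p i j l + dMetric p j i l - dMetric p l i j) * X i * Y j with hK
  have hraise : (fun k => ∑ i, ∑ j, christoffel p k i j * X i * Y j) = (metricMatrix p)⁻¹ *ᵥ K := by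
    ext k
    simp only [hK, christoffel, mulVec, dotProduct, Fin.sum_univ_three]
    ring
  rw [hraise, metric_eq_dotProduct_mulVec, mulVec_mulVec,
    mul_nonsing_inv _ (by simp [det_metricMatrix]), one_mulVec]
  simp only [hK, dMetric_eq, dContactForm, contactForm, dotProduct, Fin.sum_univ_three,
    Pi.single_eq_same, ne_eq, not_false_eq_true, Pi.single_eq_of_ne, Fin.reduceEq, one_ne_zero,
    zero_ne_one]
  ring

lemma secondForm_apply (r : ℝ × ℝ → Nil3) (q : ℝ × ℝ) (N : Nil3) (a b : Fin 2) :
    secondForm r q N a b =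
      metric (r q) (fderiv ℝ (tangent r b) q (direction a)) N +
        (contactForm (r q) (tangent r b q) * dContactForm (tangent r a q) N +
          contactForm (r q) (tangent r a q) * dContactForm (tangent r b q) N) := by
  rw [← metric_christoffel, ← metric_add_left]
  rfl

/-- The normal vector of `r` whose frame coordinates are the cross product of those of `r_x` and
`r_y`; in general it is not of unit length. -/
noncomputable def crossNormal (r : ℝ × ℝ → Nil3) (q : ℝ × ℝ) : Nil3 :=
  (frameCoord (r q)).symm
    (frameCoord (r q) (tangent r 0 q) ⨯₃ frameCoord (r q) (tangent r 1 q))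

section Normal

variable {r : ℝ × ℝ → Nil3} {q : ℝ × ℝ}

lemma frameCoord_crossNormal : frameCoord (r q) (crossNormal r q) =
    frameCoord (r q) (tangent r 0 q) ⨯₃ frameCoord (r q) (tangent r 1 q) :=
  LinearEquiv.apply_symm_apply _ _

lemma metric_tangent_crossNormal (a : Fin 2) :
    metric (r q) (tangent r a q) (crossNormal r q) = 0 := by
  rw [metric_eq_dotProduct, frameCoord_crossNormal]
  fin_cases a
  · exact dot_self_cross _ _
  · exact dot_cross_self _ _

lemma det_firstForm :
    (firstForm r q).det = metric (r q) (crossNormal r q) (crossNormal r q) := by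
  simp only [firstForm, det_fin_two, of_apply, metric_eq_dotProduct, frameCoord_crossNormal,
    cross_dot_cross]

lemma frameCoord_crossNormal_ne_zero (h : LinearIndependent ℝ fun a => tangent r a q) :
    frameCoord (r q) (crossNormal r q) ≠ 0 := by
  rw [frameCoord_crossNormal, crossProduct_ne_zero_iff_linearIndependent]
  have hframe := h.map' (frameCoord (r q)).toLinearMap (frameCoord (r q)).ker
  have hpair : (frameCoord (r q)).toLinearMap ∘ (fun a => tangent r a q) =
      ![frameCoord (r q) (tangent r 0 q), frameCoord (r q) (tangent r 1 q)] := by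
    ext a : 1
    fin_cases a <;> rfl
  rwa [hpair] at hframe

lemma metric_crossNormal_self_pos (h : LinearIndependent ℝ fun a => tangent r a q) :
    0 < metric (r q) (crossNormal r q) (crossNormal r q) := by
  rw [metric_eq_dotProduct]
  simpa using dotProduct_star_self_pos_iff.2 (frameCoord_crossNormal_ne_zero h)

lemma exists_eq_smul_crossNormal (h : LinearIndependent ℝ fun a => tangent r a q) {N : Nil3}
    (hN : ∀ a, metric (r q) (tangent r a q) N = 0) : ∃ t : ℝ, N = t • crossNormal r q := by
  have hcross : frameCoord (r q) (crossNormal r q) ⨯₃ frameCoord (r q) N = 0 := by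
    rw [frameCoord_crossNormal, cross_cross_eq_smul_sub_smul, ← metric_eq_dotProduct,
      ← metric_eq_dotProduct, hN 0, hN 1, zero_smul, zero_smul, sub_zero]
  have hdep := mt crossProduct_ne_zero_iff_linearIndependent.2 (not_not.2 hcross)
  rw [LinearIndependent.pair_iff' (frameCoord_crossNormal_ne_zero h)] at hdep
  push Not at hdep
  obtain ⟨t, ht⟩ := hdep
  exact ⟨t, (frameCoord (r q)).injective (by rw [map_smul, ht])⟩

lemma meanCurvature_smul (t : ℝ) (N : Nil3) :
    meanCurvature r q (t • N) = t * meanCurvature r q N := by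
  have hsecond : secondForm r q (t • N) = t • secondForm r q N := by
    ext a b
    exact metric_smul_right _ _ _ _
  rw [meanCurvature, meanCurvature, hsecond, mul_smul_comm, trace_smul, smul_eq_mul]
  ring

theorem forall_isUnitNormal_meanCurvature_eq_zero_iff
    (h : LinearIndependent ℝ fun a => tangent r a q) :
    (∀ N, IsUnitNormal r q N → meanCurvature r q N = 0) ↔
      meanCurvature r q (crossNormal r q) = 0 := by
  constructor
  · intro hmin
    set D := metric (r q) (crossNormal r q) (crossNormal r q) with hD
    have hDpos : 0 < D := metric_crossNormal_self_pos h
    have hunit : IsUnitNormal r q ((√D)⁻¹ • crossNormal r q) := by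
      refine ⟨?_, fun a => ?_⟩
      · rw [metric_smul_left, metric_smul_right, ← hD, ← mul_assoc, ← mul_inv,
          Real.mul_self_sqrt hDpos.le, inv_mul_cancel₀ hDpos.ne']
      · rw [metric_smul_right, metric_tangent_crossNormal, mul_zero]
    have hzero := hmin _ hunit
    rw [meanCurvature_smul] at hzero
    exact (mul_eq_zero.1 hzero).resolve_left (inv_ne_zero (Real.sqrt_ne_zero'.2 hDpos))
  · rintro hzero N ⟨-, hN⟩
    obtain ⟨t, rfl⟩ := exists_eq_smul_crossNormal h hN
    rw [meanCurvature_smul, hzero, mul_zero]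

lemma meanCurvature_eq_zero_iff (h : LinearIndependent ℝ fun a => tangent r a q) (N : Nil3) :
    meanCurvature r q N = 0 ↔ ((firstForm r q).adjugate * secondForm r q N).trace = 0 := by
  have hdet : (firstForm r q).det ≠ 0 := det_firstForm.trans_ne (metric_crossNormal_self_pos h).ne'
  rw [meanCurvature, inv_def, Ring.inverse_eq_inv', smul_mul_assoc, trace_smul]
  simp [hdet]

end Normal

lemma hasFDerivAt_vec3 {E : Type*} [NormedAddCommGroup E] [NormedSpace ℝ E]
    {f g h : E → ℝ} {f' g' h' : E →L[ℝ] ℝ} {q : E}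
    (hf : HasFDerivAt f f' q) (hg : HasFDerivAt g g' q) (hh : HasFDerivAt h h' q) :
    HasFDerivAt (fun q => ![f q, g q, h q]) (ContinuousLinearMap.pi ![f', g', h']) q := by
  rw [hasFDerivAt_pi']
  intro i
  fin_cases i
  exacts [hf, hg, hh]

lemma type6Surface_apply (u v : ℝ → ℝ) (x y : ℝ) :
    type6Surface u v (x, y) = ![y, x + v y, u x + x * y / 2] := by
  ext i
  fin_cases i <;> simp [type6Surface, mul] <;> ring

/-- The contact form on the tangent vector `r_y` of the surface of type 6, which does not involve
`u`. -/
noncomputable def contactY (v : ℝ → ℝ) (x y : ℝ) : ℝ := x + (v y - y * deriv v y) / 2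

/-- The numerator of the mean curvature of the surface of type 6: the surface is minimal where it
vanishes. -/
noncomputable def minimalOperator (u v : ℝ → ℝ) (x y : ℝ) : ℝ :=
  (1 + deriv u x ^ 2) * (deriv u x + y / 2) * deriv (deriv v) y + deriv u x * contactY v x y +
    deriv v y - (1 + deriv v y ^ 2 + contactY v x y ^ 2) * deriv (deriv u) x

section FirstOrder

variable {u v : ℝ → ℝ} {x y : ℝ}

lemma hasFDerivAt_type6Surface (hu : DifferentiableAt ℝ u x) (hv : DifferentiableAt ℝ v y) :
    HasFDerivAt (type6Surface u v)
      (ContinuousLinearMap.pi ![ContinuousLinearMap.snd ℝ ℝ ℝ,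
        ContinuousLinearMap.fst ℝ ℝ ℝ + deriv v y • ContinuousLinearMap.snd ℝ ℝ ℝ,
        (deriv u x + y / 2) • ContinuousLinearMap.fst ℝ ℝ ℝ +
          (x / 2) • ContinuousLinearMap.snd ℝ ℝ ℝ]) (x, y) := by
  have hx : HasFDerivAt Prod.fst (ContinuousLinearMap.fst ℝ ℝ ℝ) (x, y) := hasFDerivAt_fst
  have hy : HasFDerivAt Prod.snd (ContinuousLinearMap.snd ℝ ℝ ℝ) (x, y) := hasFDerivAt_snd
  refine (hasFDerivAt_vec3 hy (hx.add (hv.hasDerivAt.comp_hasFDerivAt (x, y) hy))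
    (((hu.hasDerivAt.comp_hasFDerivAt (x, y) hx).add ((hx.mul hy).mul_const 2⁻¹)).congr_fderiv
      ?_)).congr_of_eventuallyEq (.of_forall fun q => type6Surface_apply u v q.1 q.2)
  ext <;> simp <;> ring

lemma tangent_zero_type6Surface (hu : DifferentiableAt ℝ u x) (hv : DifferentiableAt ℝ v y) :
    tangent (type6Surface u v) 0 (x, y) = ![0, 1, deriv u x + y / 2] := by
  ext i
  fin_cases i <;> simp [tangent, (hasFDerivAt_type6Surface hu hv).fderiv, direction]

lemma tangent_one_type6Surface (hu : DifferentiableAt ℝ u x) (hv : DifferentiableAt ℝ v y) :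
    tangent (type6Surface u v) 1 (x, y) = ![1, deriv v y, x / 2] := by
  ext i
  fin_cases i <;> simp [tangent, (hasFDerivAt_type6Surface hu hv).fderiv, direction]

lemma contactForm_type6Surface_zero (u v : ℝ → ℝ) (x y : ℝ) :
    contactForm (type6Surface u v (x, y)) ![0, 1, deriv u x + y / 2] = deriv u x := by
  simp only [contactForm, type6Surface_apply, cons_val]
  ring

lemma contactForm_type6Surface_one (u v : ℝ → ℝ) (x y : ℝ) :
    contactForm (type6Surface u v (x, y)) ![1, deriv v y, x / 2] = contactY v x y := by
  simp only [contactForm, type6Surface_apply, contactY, cons_val]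
  ring

lemma linearIndependent_tangent_type6Surface (hu : DifferentiableAt ℝ u x)
    (hv : DifferentiableAt ℝ v y) :
    LinearIndependent ℝ fun a => tangent (type6Surface u v) a (x, y) := by
  rw [linearIndependent_fin2, tangent_zero_type6Surface hu hv, tangent_one_type6Surface hu hv]
  refine ⟨fun h => by simpa using congrFun h 0, fun a h => ?_⟩
  have ha : a = 0 := by simpa using congrFun h 0
  simpa [ha] using congrFun h 1

lemma firstForm_type6Surface (hu : DifferentiableAt ℝ u x) (hv : DifferentiableAt ℝ v y) :
    firstForm (type6Surface u v) (x, y) =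
      !![1 + deriv u x ^ 2, deriv v y + deriv u x * contactY v x y;
        deriv v y + deriv u x * contactY v x y, 1 + deriv v y ^ 2 + contactY v x y ^ 2] := by
  ext a b
  fin_cases a <;> fin_cases b <;>
    simp [firstForm, metric, tangent_zero_type6Surface hu hv, tangent_one_type6Surface hu hv,
      contactForm_type6Surface_zero, contactForm_type6Surface_one] <;> ring

lemma frameCoord_crossNormal_type6Surface (hu : DifferentiableAt ℝ u x)
    (hv : DifferentiableAt ℝ v y) :
    frameCoord (type6Surface u v (x, y)) (crossNormal (type6Surface u v) (x, y)) =
      ![contactY v x y - deriv u x * deriv v y, deriv u x, -1] := by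
  rw [frameCoord_crossNormal, frameCoord_apply, frameCoord_apply,
    tangent_zero_type6Surface hu hv, tangent_one_type6Surface hu hv,
    contactForm_type6Surface_zero, contactForm_type6Surface_one, cross_apply]
  simp

end FirstOrder

section SecondOrder

variable {u v : ℝ → ℝ} {x y : ℝ}
  (hu : ∀ᶠ t in 𝓝 x, DifferentiableAt ℝ u t) (hv : ∀ᶠ t in 𝓝 y, DifferentiableAt ℝ v t)

include hu hv

lemma fderiv_tangent_zero_type6Surface (hu' : DifferentiableAt ℝ (deriv u) x) (a b : ℝ) :
    fderiv ℝ (tangent (type6Surface u v) 0) (x, y) (a, b) =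
      ![0, 0, a * deriv (deriv u) x + b / 2] := by
  have htangent : tangent (type6Surface u v) 0 =ᶠ[𝓝 (x, y)]
      fun q => ![0, 1, deriv u q.1 + q.2 / 2] :=
    (hu.prod_nhds hv).mono fun q hq => tangent_zero_type6Surface hq.1 hq.2
  have hfst : HasFDerivAt Prod.fst (ContinuousLinearMap.fst ℝ ℝ ℝ) (x, y) := hasFDerivAt_fst
  have hderiv := (hasFDerivAt_vec3 (hasFDerivAt_const 0 (x, y)) (hasFDerivAt_const 1 (x, y))
    ((hu'.hasDerivAt.comp_hasFDerivAt (x, y) hfst).add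
      (hasFDerivAt_snd.mul_const 2⁻¹))).congr_of_eventuallyEq htangent
  rw [hderiv.fderiv]
  ext i
  fin_cases i <;> simp
  ring

lemma fderiv_tangent_one_type6Surface (hv' : DifferentiableAt ℝ (deriv v) y) (a b : ℝ) :
    fderiv ℝ (tangent (type6Surface u v) 1) (x, y) (a, b) =
      ![0, b * deriv (deriv v) y, a / 2] := by
  have htangent : tangent (type6Surface u v) 1 =ᶠ[𝓝 (x, y)]
      fun q => ![1, deriv v q.2, q.1 / 2] :=
    (hu.prod_nhds hv).mono fun q hq => tangent_one_type6Surface hq.1 hq.2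
  have hsnd : HasFDerivAt Prod.snd (ContinuousLinearMap.snd ℝ ℝ ℝ) (x, y) := hasFDerivAt_snd
  have hderiv := (hasFDerivAt_vec3 (hasFDerivAt_const 1 (x, y))
    (hv'.hasDerivAt.comp_hasFDerivAt (x, y) hsnd)
    (hasFDerivAt_fst.mul_const 2⁻¹)).congr_of_eventuallyEq htangent
  rw [hderiv.fderiv]
  ext i
  fin_cases i <;> simp <;> ring

lemma secondForm_type6Surface (hu' : DifferentiableAt ℝ (deriv u) x)
    (hv' : DifferentiableAt ℝ (deriv v) y) :
    let p := deriv u x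
    let m := deriv v y
    let w := contactY v x y
    secondForm (type6Surface u v) (x, y) (crossNormal (type6Surface u v) (x, y)) =
      !![p * (w - p * m) - deriv (deriv u) x, (w ^ 2 - p ^ 2 * m ^ 2 - p ^ 2 - 1) / 2;
        (w ^ 2 - p ^ 2 * m ^ 2 - p ^ 2 - 1) / 2,
        m * w * (w - p * m) + p * (deriv (deriv v) y - w) + y * deriv (deriv v) y / 2] := by
  intro p m w
  have hnormal := frameCoord_crossNormal_type6Surface hu.self_of_nhds hv.self_of_nhds
  set N := crossNormal (type6Surface u v) (x, y)
  have hN₀ : N 0 = w - p * m := congrFun hnormal 0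
  have hN₁ : N 1 = p := congrFun hnormal 1
  have hN₂ : contactForm (type6Surface u v (x, y)) N = -1 := congrFun hnormal 2
  ext a b
  rw [secondForm_apply]
  fin_cases a <;> fin_cases b <;>
    simp [metric, dContactForm, direction, hN₀, hN₁, hN₂,
      fderiv_tangent_zero_type6Surface hu hv hu', fderiv_tangent_one_type6Surface hu hv hv',
      tangent_zero_type6Surface hu.self_of_nhds hv.self_of_nhds,
      tangent_one_type6Surface hu.self_of_nhds hv.self_of_nhds,
      contactForm_type6Surface_zero, contactForm_type6Surface_one, p, m, w] <;>
    simp [contactForm, type6Surface_apply] <;> ring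

lemma meanCurvature_crossNormal_type6Surface_eq_zero_iff
    (hu' : DifferentiableAt ℝ (deriv u) x) (hv' : DifferentiableAt ℝ (deriv v) y) :
    meanCurvature (type6Surface u v) (x, y) (crossNormal (type6Surface u v) (x, y)) = 0 ↔
      minimalOperator u v x y = 0 := by
  rw [meanCurvature_eq_zero_iff
    (linearIndependent_tangent_type6Surface hu.self_of_nhds hv.self_of_nhds),
    firstForm_type6Surface hu.self_of_nhds hv.self_of_nhds,
    secondForm_type6Surface hu hv hu' hv', adjugate_fin_two_of, trace_fin_two]
  refine Eq.congr_left ?_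
  simp only [minimalOperator, mul_apply, Fin.sum_univ_two, of_apply, cons_val', cons_val_zero,
    cons_val_one, cons_val_fin_one]
  ring

end SecondOrder

lemma contDiffOn_type6Surface {n : WithTop ℕ∞} {I J : Set ℝ} {u v : ℝ → ℝ}
    (hu : ContDiffOn ℝ n u I) (hv : ContDiffOn ℝ n v J) :
    ContDiffOn ℝ n (type6Surface u v) (I ×ˢ J) := by
  have hu' : ContDiffOn ℝ n (fun q : ℝ × ℝ => u q.1) (I ×ˢ J) :=
    hu.comp contDiffOn_fst fun q hq => hq.1
  have hv' : ContDiffOn ℝ n (fun q : ℝ × ℝ => v q.2) (I ×ˢ J) :=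
    hv.comp contDiffOn_snd fun q hq => hq.2
  have hsurface : type6Surface u v = fun q => ![q.2, q.1 + v q.2, u q.1 + q.1 * q.2 / 2] :=
    funext fun q => type6Surface_apply u v q.1 q.2
  rw [hsurface, contDiffOn_pi]
  intro i
  fin_cases i
  · exact contDiffOn_snd
  · exact contDiffOn_fst.add hv'
  · exact hu'.add ((contDiffOn_fst.mul contDiffOn_snd).div_const 2)

theorem isMinimal_type6Surface_iff {I J : Set ℝ} (hI : IsOpen I) (hJ : IsOpen J) {u v : ℝ → ℝ}
    (hu : ContDiffOn ℝ ∞ u I) (hv : ContDiffOn ℝ ∞ v J) :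
    IsMinimal (type6Surface u v) (I ×ˢ J) ↔ ∀ x ∈ I, ∀ y ∈ J, minimalOperator u v x y = 0 := by
  have hdiff {f : ℝ → ℝ} {s : Set ℝ} (hs : IsOpen s) (hf : ContDiffOn ℝ ∞ f s) {t : ℝ}
      (ht : t ∈ s) : DifferentiableAt ℝ f t :=
    (hf.contDiffAt (hs.mem_nhds ht)).differentiableAt (by simp)
  have hev {f : ℝ → ℝ} {s : Set ℝ} (hs : IsOpen s) (hf : ContDiffOn ℝ ∞ f s) {t : ℝ}
      (ht : t ∈ s) : ∀ᶠ t in 𝓝 t, DifferentiableAt ℝ f t :=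
    (hs.eventually_mem ht).mono fun _ => hdiff hs hf
  have hu' := hu.deriv_of_isOpen (m := ∞) hI (by simp)
  have hv' := hv.deriv_of_isOpen (m := ∞) hJ (by simp)
  rw [IsMinimal, and_iff_right (contDiffOn_type6Surface hu hv), Set.forall_prod_set]
  refine forall₂_congr fun x hx => forall₂_congr fun y hy => ?_
  have hind := linearIndependent_tangent_type6Surface (hdiff hI hu hx) (hdiff hJ hv hy)
  rw [and_iff_right hind, forall_isUnitNormal_meanCurvature_eq_zero_iff hind,
    meanCurvature_crossNormal_type6Surface_eq_zero_iff (hev hI hu hx) (hev hJ hv hy)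
      (hdiff hI hu' hx) (hdiff hJ hv' hy)]

open Polynomial

/-- The logarithmic derivative `v''' / v''`, which governs the `y`-derivatives of the minimal
surface equation where `v'' ≠ 0`. -/
noncomputable def curvatureRate (v : ℝ → ℝ) : ℝ → ℝ := logDeriv (deriv (deriv v))

section Curved

variable {J : Set ℝ} {u v : ℝ → ℝ} {x y : ℝ}

lemma hasDerivAt_contactY (hJ : IsOpen J) (hv : ContDiffOn ℝ ∞ v J) (hy : y ∈ J) :
    HasDerivAt (contactY v x) (-(y * deriv (deriv v) y / 2)) y := by
  obtain ⟨dv, hm⟩ := (contDiffOn_infty_iff_deriv_of_isOpen hJ).1 hv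
  have dm := (hm.differentiableOn (by simp)).hasDerivAt (hJ.mem_nhds hy)
  refine ((((dv.hasDerivAt (hJ.mem_nhds hy)).fun_sub ((hasDerivAt_id' y).fun_mul dm)).div_const
    2).const_add x).congr_deriv ?_
  ring

variable (hJ : IsOpen J) (hv : ContDiffOn ℝ ∞ v J) (hv₂ : ∀ y ∈ J, deriv (deriv v) y ≠ 0)

include hJ hv hv₂

lemma contDiffOn_curvatureRate : ContDiffOn ℝ ∞ (curvatureRate v) J := by
  have hV := ((contDiffOn_infty_iff_deriv_of_isOpen hJ).1
    ((contDiffOn_infty_iff_deriv_of_isOpen hJ).1 hv).2).2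
  exact ((contDiffOn_infty_iff_deriv_of_isOpen hJ).1 hV).2.div hV hv₂

lemma hasDerivAt_deriv_deriv (hy : y ∈ J) :
    HasDerivAt (deriv (deriv v)) (curvatureRate v y * deriv (deriv v) y) y := by
  have hV := ((contDiffOn_infty_iff_deriv_of_isOpen hJ).1
    ((contDiffOn_infty_iff_deriv_of_isOpen hJ).1 hv).2).2
  exact ((hV.differentiableOn (by simp)).hasDerivAt (hJ.mem_nhds hy)).congr_deriv
    (div_mul_cancel₀ _ (hv₂ y hy)).symm

variable (h : ∀ y ∈ J, minimalOperator u v x y = 0)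

include h

/-- The `y`-derivative of `minimalOperator u v x y`, divided by `deriv (deriv v) y`. -/
lemma first_deriv_minimalOperator (hy : y ∈ J) :
    (2 * deriv v y - y * contactY v x y) * deriv (deriv u) x =
      (1 + deriv u x ^ 2) * (1 / 2 + (deriv u x + y / 2) * curvatureRate v y) -
        deriv u x * y / 2 + 1 := by
  have hm := (((contDiffOn_infty_iff_deriv_of_isOpen hJ).1 hv).2.differentiableOn
    (by simp)).hasDerivAt (hJ.mem_nhds hy)
  have hV := hasDerivAt_deriv_deriv hJ hv hv₂ hy
  have hw := hasDerivAt_contactY (x := x) hJ hv hy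
  have hderiv := hasDerivAt_unique_of_eqOn hJ hy h
    ((((((hasDerivAt_id' y).div_const 2).const_add (deriv u x)).const_mul
      (1 + deriv u x ^ 2)).fun_mul hV
      |>.fun_add (hw.const_mul (deriv u x)) |>.fun_add hm).fun_sub
      ((((hm.fun_pow 2).const_add 1).fun_add (hw.fun_pow 2)).mul_const (deriv (deriv u) x)))
    (hasDerivAt_const y 0)
  refine mul_left_cancel₀ (hv₂ y hy) ?_
  simp only [Nat.cast_ofNat, Nat.add_one_sub_one, pow_one] at hderiv
  linear_combination -hderiv

lemma second_deriv_minimalOperator (hy : y ∈ J) :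
    (2 * deriv (deriv v) y - contactY v x y + y ^ 2 * deriv (deriv v) y / 2) * deriv (deriv u) x =
      (1 + deriv u x ^ 2) *
        (curvatureRate v y / 2 + (deriv u x + y / 2) * deriv (curvatureRate v) y) -
          deriv u x / 2 := by
  have hm := (((contDiffOn_infty_iff_deriv_of_isOpen hJ).1 hv).2.differentiableOn
    (by simp)).hasDerivAt (hJ.mem_nhds hy)
  have hw := hasDerivAt_contactY (x := x) hJ hv hy
  have hL := ((contDiffOn_curvatureRate hJ hv hv₂).differentiableOn (by simp)).hasDerivAt
    (hJ.mem_nhds hy)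
  have hderiv := hasDerivAt_unique_of_eqOn hJ hy
    (fun y hy => first_deriv_minimalOperator hJ hv hv₂ h hy)
    (((hm.const_mul 2).fun_sub ((hasDerivAt_id' y).fun_mul hw)).mul_const (deriv (deriv u) x))
    ((((((((hasDerivAt_id' y).div_const 2).const_add (deriv u x)).fun_mul hL).const_add
      (1 / 2)).const_mul (1 + deriv u x ^ 2)).fun_sub
        (((hasDerivAt_id' y).const_mul (deriv u x)).div_const 2)).add_const 1)
  linear_combination hderiv

lemma third_deriv_minimalOperator (hy : y ∈ J) :
    deriv (deriv v) y * (2 * curvatureRate v y + 3 / 2 * y + y ^ 2 * curvatureRate v y / 2) *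
      deriv (deriv u) x =
      (1 + deriv u x ^ 2) * (deriv (curvatureRate v) y +
        (deriv u x + y / 2) * deriv (deriv (curvatureRate v)) y) := by
  have hV := hasDerivAt_deriv_deriv hJ hv hv₂ hy
  have hw := hasDerivAt_contactY (x := x) hJ hv hy
  obtain ⟨dL, hL'⟩ := (contDiffOn_infty_iff_deriv_of_isOpen hJ).1
    (contDiffOn_curvatureRate hJ hv hv₂)
  have hderiv := hasDerivAt_unique_of_eqOn hJ hy
    (fun y hy => second_deriv_minimalOperator hJ hv hv₂ h hy)
    ((((hV.const_mul 2).fun_sub hw).fun_add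
      (((hasDerivAt_pow 2 y).fun_mul hV).div_const 2)).mul_const (deriv (deriv u) x))
    (((((dL.hasDerivAt (hJ.mem_nhds hy)).div_const 2).fun_add
      ((((hasDerivAt_id' y).div_const 2).const_add (deriv u x)).fun_mul
        ((hL'.differentiableOn (by simp)).hasDerivAt (hJ.mem_nhds hy)))).const_mul
          (1 + deriv u x ^ 2)).sub_const (deriv u x / 2))
  simp only [Nat.cast_ofNat, Nat.add_one_sub_one, pow_one] at hderiv
  linear_combination hderiv

end Curved

lemma exists_add_sq_mul_ne_zero_of_hasDerivAt_zero {J : Set ℝ} (hJ : IsOpen J) (hJne : J.Nonempty)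
    {L : ℝ → ℝ} (hL : ∀ y ∈ J, HasDerivAt L 0 y) :
    ∃ y ∈ J, 2 * L y + 3 / 2 * y + y ^ 2 * L y / 2 ≠ 0 := by
  by_contra! hzero
  have hmul (y) (hy : y ∈ J) : y * L y = -(3 / 2) := by
    have hderiv := hasDerivAt_unique_of_eqOn hJ hy hzero
      ((((hL y hy).const_mul 2).fun_add ((hasDerivAt_id' y).const_mul (3 / 2))).fun_add
        (((hasDerivAt_pow 2 y).fun_mul (hL y hy)).div_const 2)) (hasDerivAt_const y 0)
    simp only [Nat.cast_ofNat, Nat.add_one_sub_one, pow_one] at hderiv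
    linear_combination hderiv
  obtain ⟨y, hy⟩ := hJne
  have hLy : L y = 0 := by
    have hderiv := hasDerivAt_unique_of_eqOn hJ hy hmul
      ((hasDerivAt_id' y).fun_mul (hL y hy)) (hasDerivAt_const y _)
    linear_combination hderiv
  have := hmul y hy
  norm_num [hLy] at this

section Classification

variable {I J : Set ℝ} {u v : ℝ → ℝ}

section Curved

variable (hI : IsOpen I) (hJ : IsOpen J) (hv : ContDiffOn ℝ ∞ v J)
  (hv₂ : ∀ y ∈ J, deriv (deriv v) y ≠ 0) (h : ∀ x ∈ I, ∀ y ∈ J, minimalOperator u v x y = 0)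

include hI hJ hv hv₂ h

lemma deriv_deriv_eq_zero_of_ne_zero {x y : ℝ} (hx : x ∈ I) (hy : y ∈ J)
    (hne : 2 * curvatureRate v y + 3 / 2 * y + y ^ 2 * curvatureRate v y / 2 ≠ 0) :
    deriv (deriv u) x = 0 := by
  set L := curvatureRate v
  set α := deriv (deriv v) y * (2 * L y + 3 / 2 * y + y ^ 2 * L y / 2)
  have hα : α ≠ 0 := mul_ne_zero (hv₂ y hy) hne
  have h₁ : ∀ᶠ t in 𝓝 x, deriv (deriv u) t = (1 + deriv u t ^ 2) *
      (deriv (deriv L) y / α * deriv u t + (deriv L y + y / 2 * deriv (deriv L) y) / α) := by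
    filter_upwards [hI.mem_nhds hx] with t ht
    have hthird : α * deriv (deriv u) t = _ :=
      third_deriv_minimalOperator hJ hv hv₂ (h t ht) hy
    field_simp
    linear_combination 2 * hthird
  refine deriv_eq_zero_of_two_odes h₁ (m := deriv L y) (n := L y / 2 + y / 2 * deriv L y)
    (B := 2 * deriv (deriv v) y - (v y - y * deriv v y) / 2 + y ^ 2 * deriv (deriv v) y / 2) ?_
  filter_upwards [hI.mem_nhds hx] with t ht
  have hsecond := second_deriv_minimalOperator hJ hv hv₂ (h t ht) hy
  rw [contactY] at hsecond
  linear_combination -hsecond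

lemma deriv_deriv_eq_zero_of_curved (hJne : J.Nonempty) {x : ℝ} (hx : x ∈ I) :
    deriv (deriv u) x = 0 := by
  by_contra hP
  set L := curvatureRate v
  have hα (y) (hy : y ∈ J) : 2 * L y + 3 / 2 * y + y ^ 2 * L y / 2 = 0 :=
    of_not_not fun hne => hP (deriv_deriv_eq_zero_of_ne_zero hI hJ hv hv₂ h hx hy hne)
  have hL (y) (hy : y ∈ J) : deriv L y = 0 := by
    have hroot : ∀ᶠ t in 𝓝 x,
        (C (deriv L y) + (X + C (y / 2)) * C (deriv (deriv L) y)).eval (deriv u t) = 0 := by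
      filter_upwards [hI.mem_nhds hx] with t ht
      have hthird := third_deriv_minimalOperator hJ hv hv₂ (h t ht) hy
      rw [hα y hy, mul_zero, zero_mul, eq_comm] at hthird
      simpa using (mul_eq_zero.1 hthird).resolve_left (by positivity)
    have hzero := eq_zero_of_eventually_eval_eq_zero
      (differentiableAt_of_deriv_ne_zero hP).hasDerivAt hP hroot
    simpa using congrArg (eval (-(y / 2))) hzero
  have dL := (contDiffOn_curvatureRate hJ hv hv₂).differentiableOn (by simp)
  obtain ⟨y, hy, hne⟩ := exists_add_sq_mul_ne_zero_of_hasDerivAt_zero hJ hJne fun y hy =>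
    hL y hy ▸ dL.hasDerivAt (hJ.mem_nhds hy)
  exact hne (hα y hy)

end Curved

lemma deriv_eq_zero_of_deriv_deriv_eq_zero {y : ℝ} (hI : IsOpen I)
    (hp : DifferentiableOn ℝ (deriv u) I) (hP : ∀ x ∈ I, deriv (deriv u) x = 0)
    (h : ∀ x ∈ I, minimalOperator u v x y = 0) {x : ℝ} (hx : x ∈ I) : deriv u x = 0 := by
  have hp₀ : HasDerivAt (deriv u) 0 x := hP x hx ▸ hp.hasDerivAt (hI.mem_nhds hx)
  have hred : ∀ t ∈ I, (1 + deriv u t ^ 2) * (deriv u t + y / 2) * deriv (deriv v) y +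
      deriv u t * contactY v t y + deriv v y = 0 := fun t ht => by
    simpa [minimalOperator, hP t ht] using h t ht
  have hderiv := hasDerivAt_unique_of_eqOn hI hx hred
    ((((((hp₀.fun_pow 2).const_add 1).fun_mul (hp₀.add_const (y / 2))).mul_const
      (deriv (deriv v) y)).fun_add (hp₀.fun_mul ((hasDerivAt_id' x).add_const
        ((v y - y * deriv v y) / 2)))).add_const (deriv v y)) (hasDerivAt_const x 0)
  simpa using hderiv

lemma exists_eq_div_add_of_ode (hJ : IsOpen J) (hJc : J.OrdConnected)
    (hv : DifferentiableOn ℝ v J) (hv' : DifferentiableOn ℝ (deriv v) J)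
    (hode : ∀ y ∈ J, y / 2 * deriv (deriv v) y + deriv v y = 0) :
    ∃ a b, (0 ∈ J → a = 0) ∧ ∀ y ∈ J, v y = a / y + b := by
  have hconst (y) (hy : y ∈ J) : HasDerivAt (fun y => -(y ^ 2 * deriv v y)) 0 y := by
    refine (((hasDerivAt_pow 2 y).fun_mul (hv'.hasDerivAt (hJ.mem_nhds hy))).fun_neg).congr_deriv ?_
    simp only [Nat.cast_ofNat, Nat.add_one_sub_one, pow_one]
    linear_combination -(2 * y) * hode y hy
  obtain ⟨a, ha⟩ := exists_eq_add_of_hasDerivAt hJ hJc hconst fun y _ => hasDerivAt_const y 0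
  have ha₀ (h0 : 0 ∈ J) : a = 0 := by simpa using (ha 0 h0).symm
  have hm (y) (hy : y ∈ J) : deriv v y = -a / y ^ 2 := by
    rcases eq_or_ne y 0 with rfl | hy₀
    · simpa using hode 0 hy
    · rw [eq_div_iff (pow_ne_zero 2 hy₀)]
      linear_combination -ha y hy
  obtain ⟨b, hb⟩ := exists_eq_add_of_hasDerivAt hJ hJc
    (fun y hy => hm y hy ▸ hv.hasDerivAt (hJ.mem_nhds hy))
    fun y hy => hasDerivAt_const_div (by grind)
  exact ⟨a, b, ha₀, hb⟩

lemma minimalOperator_eq_zero_of_const {u₀ a b x y : ℝ} (hI : IsOpen I) (hJ : IsOpen J)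
    (hu : ∀ x ∈ I, u x = u₀) (ha : 0 ∈ J → a = 0) (hv : ∀ y ∈ J, v y = a / y + b)
    (hx : x ∈ I) (hy : y ∈ J) : minimalOperator u v x y = 0 := by
  have hp : Set.EqOn (deriv u) (fun _ => 0) I := by
    simpa using Set.EqOn.deriv hu hI
  have hP : deriv (deriv u) x = 0 := by simpa using hp.deriv hI hx
  have hay (y) (hy : y ∈ J) : a = 0 ∨ y ≠ 0 := by grind
  have hm : Set.EqOn (deriv v) (fun y => -a / y ^ 2) J := fun y hy =>
    (Set.EqOn.deriv hv hJ hy).trans ((hasDerivAt_const_div (hay y hy)).add_const b).deriv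
  rw [minimalOperator, hp hx, hP]
  rcases hay y hy with rfl | hy₀
  · have hV : deriv (deriv v) y = 0 := by simpa using hm.deriv hJ hy
    rw [hm hy, hV]
    ring
  · have hV : deriv (deriv v) y = 2 * a / y ^ 3 := by
      refine (hm.deriv hJ hy).trans (HasDerivAt.deriv (((hasDerivAt_const y (-a)).fun_div
        (hasDerivAt_pow 2 y) (pow_ne_zero 2 hy₀)).congr_deriv ?_))
      field_simp
      ring
    rw [hm hy, hV]
    field_simp
    ring

/-- The square root in the height profile of the minimal surfaces of type 6 with
`v y = a * y + b`. -/
noncomputable def radical (a b x : ℝ) : ℝ := √(4 * (1 + a ^ 2) + (2 * x + b) ^ 2)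

/-- The height profile `u` of the minimal surfaces of type 6 with `v y = a * y + b`. -/
noncomputable def profile (a b c c₁ x : ℝ) : ℝ :=
  (a * x ^ 2 + a * b * x + c) / (2 * (1 + a ^ 2)) + c₁ * (x / 2 + b / 4) * radical a b x +
    c₁ * (1 + a ^ 2) * Real.log (2 * x + b + radical a b x)

lemma radical_pos (a b x : ℝ) : 0 < radical a b x := Real.sqrt_pos.2 (by positivity)

lemma sq_radical (a b x : ℝ) : radical a b x ^ 2 = 4 * (1 + a ^ 2) + (2 * x + b) ^ 2 :=
  Real.sq_sqrt (by positivity)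

lemma hasDerivAt_two_mul_add (b x : ℝ) : HasDerivAt (fun x => 2 * x + b) 2 x := by
  simpa using ((hasDerivAt_id' x).const_mul 2).add_const b

lemma hasDerivAt_radical (a b x : ℝ) :
    HasDerivAt (radical a b) (2 * (2 * x + b) / radical a b x) x :=
  ((hasDerivAt_sqrt_add_sq (by positivity) _).comp x (hasDerivAt_two_mul_add b x)).congr_deriv
    (div_mul_eq_mul_div _ _ _ |>.trans (by rw [mul_comm, radical]))

lemma hasDerivAt_profile (a b c c₁ x : ℝ) :
    HasDerivAt (profile a b c c₁) (a * (x + b / 2) / (1 + a ^ 2) + c₁ * radical a b x) x := by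
  have hpoly := ((((hasDerivAt_pow 2 x).const_mul a).fun_add
    ((hasDerivAt_id' x).const_mul (a * b))).add_const c).div_const (2 * (1 + a ^ 2))
  have hlog := ((hasDerivAt_mul_sqrt_add_log (k := 4 * (1 + a ^ 2)) (by positivity) _).comp x
    (hasDerivAt_two_mul_add b x)).const_mul (c₁ / 4)
  refine ((hpoly.fun_add hlog).congr_deriv ?_).congr_of_eventuallyEq (.of_forall fun t => ?_)
  · simp only [Nat.cast_ofNat, Nat.add_one_sub_one, pow_one, radical]
    field_simp
    ring
  · simp only [profile, radical, Function.comp_apply]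
    ring

lemma exists_eq_profile_of_ode {a b : ℝ} (hI : IsOpen I) (hIc : I.OrdConnected)
    (hu : DifferentiableOn ℝ u I) (hu' : DifferentiableOn ℝ (deriv u) I)
    (hode : ∀ x ∈ I, (1 + a ^ 2 + (x + b / 2) ^ 2) * deriv (deriv u) x =
      deriv u x * (x + b / 2) + a) :
    ∃ c c₁, ∀ x ∈ I, u x = profile a b c c₁ x := by
  obtain ⟨c₁, hc₁⟩ := exists_eq_const_mul_of_wronskian_eq_zero hI hIc
    (fun x hx => (hu'.hasDerivAt (hI.mem_nhds hx)).fun_sub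
      ((((hasDerivAt_id' x).add_const (b / 2)).const_mul a).div_const (1 + a ^ 2)))
    (fun x _ => hasDerivAt_radical a b x) (fun x _ => (radical_pos a b x).ne') fun x hx => by
      have hR := (radical_pos a b x).ne'
      rw [mul_div_assoc', eq_div_iff hR, mul_assoc, ← sq, sq_radical]
      field_simp
      linear_combination 4 * (1 + a ^ 2) * hode x hx
  obtain ⟨d, hd⟩ := exists_eq_add_of_hasDerivAt hI hIc
    (fun x hx => hu.hasDerivAt (hI.mem_nhds hx))
    fun x hx => (hasDerivAt_profile a b 0 c₁ x).congr_deriv (by rw [← hc₁ x hx]; ring)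
  refine ⟨2 * (1 + a ^ 2) * d, c₁, fun x hx => ?_⟩
  rw [hd x hx, profile, profile]
  field_simp
  ring

lemma minimalOperator_of_affine {a b x y : ℝ} (hJ : IsOpen J) (hv : ∀ y ∈ J, v y = a * y + b)
    (hy : y ∈ J) : minimalOperator u v x y =
      deriv u x * (x + b / 2) + a - (1 + a ^ 2 + (x + b / 2) ^ 2) * deriv (deriv u) x := by
  have hm : Set.EqOn (deriv v) (fun _ => a) J := fun y hy => by
    simpa using Set.EqOn.deriv hv hJ hy
  have hV : deriv (deriv v) y = 0 := by simpa using hm.deriv hJ hy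
  rw [minimalOperator, contactY, hV, hm hy, hv y hy]
  ring

lemma minimalOperator_eq_zero_of_profile {a b c c₁ x y : ℝ} (hI : IsOpen I) (hJ : IsOpen J)
    (hv : ∀ y ∈ J, v y = a * y + b) (hu : ∀ x ∈ I, u x = profile a b c c₁ x)
    (hx : x ∈ I) (hy : y ∈ J) : minimalOperator u v x y = 0 := by
  have hp : Set.EqOn (deriv u)
      (fun x => a * (x + b / 2) / (1 + a ^ 2) + c₁ * radical a b x) I := fun x hx =>
    (Set.EqOn.deriv hu hI hx).trans (hasDerivAt_profile a b c c₁ x).deriv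
  have hP := (hp.deriv hI hx).trans ((((((hasDerivAt_id' x).add_const (b / 2)).const_mul
    a).div_const (1 + a ^ 2)).fun_add ((hasDerivAt_radical a b x).const_mul c₁)).deriv)
  have hR := (radical_pos a b x).ne'
  rw [minimalOperator_of_affine hJ hv hy, hp hx, hP]
  field_simp
  linear_combination 2 * (1 + a ^ 2) * c₁ * (2 * x + b) * sq_radical a b x

lemma exists_eq_const_of_deriv_deriv_ne_zero (hI : IsOpen I) (hIc : I.OrdConnected)
    (hJ : IsOpen J) (hu : ContDiffOn ℝ ∞ u I) (hv : ContDiffOn ℝ ∞ v J)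
    (hcurved : ∃ y ∈ J, deriv (deriv v) y ≠ 0)
    (h : ∀ x ∈ I, ∀ y ∈ J, minimalOperator u v x y = 0) : ∃ u₀, ∀ x ∈ I, u x = u₀ := by
  obtain ⟨y, hy, hVy⟩ := hcurved
  obtain ⟨du, hu'⟩ := (contDiffOn_infty_iff_deriv_of_isOpen hI).1 hu
  have hV := ((contDiffOn_infty_iff_deriv_of_isOpen hJ).1
    ((contDiffOn_infty_iff_deriv_of_isOpen hJ).1 hv).2).2.continuousOn
  have hsub : J ∩ deriv (deriv v) ⁻¹' {0}ᶜ ⊆ J := Set.inter_subset_left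
  have hP (x) (hx : x ∈ I) : deriv (deriv u) x = 0 :=
    deriv_deriv_eq_zero_of_curved hI (hV.isOpen_inter_preimage hJ isOpen_compl_singleton)
      (hv.mono hsub) (fun y hy => hy.2) (fun x hx y hy => h x hx y (hsub hy)) ⟨y, hy, hVy⟩ hx
  have hp (x) (hx : x ∈ I) : deriv u x = 0 :=
    deriv_eq_zero_of_deriv_deriv_eq_zero hI (hu'.differentiableOn (by simp)) hP
      (fun x hx => h x hx y hy) hx
  exact hI.exists_is_const_of_deriv_eq_zero hIc.isPreconnected du hp

lemma exists_eq_mul_add_of_deriv_deriv_eq_zero (hJ : IsOpen J) (hJc : J.OrdConnected)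
    (hv : DifferentiableOn ℝ v J) (hv' : DifferentiableOn ℝ (deriv v) J)
    (hV : ∀ y ∈ J, deriv (deriv v) y = 0) : ∃ a b, ∀ y ∈ J, v y = a * y + b := by
  obtain ⟨a, ha⟩ := hJ.exists_is_const_of_deriv_eq_zero hJc.isPreconnected hv' hV
  obtain ⟨b, hb⟩ := exists_eq_add_of_hasDerivAt hJ hJc
    (fun y hy => ha y hy ▸ hv.hasDerivAt (hJ.mem_nhds hy)) fun y _ => hasDerivAt_const_mul a
  exact ⟨a, b, hb⟩

theorem eq_const_or_eq_profile_of_minimalOperator_eq_zero (hI : IsOpen I)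
    (hIc : I.OrdConnected) (hIne : I.Nonempty) (hJ : IsOpen J) (hJc : J.OrdConnected)
    (hJne : J.Nonempty) (hu : ContDiffOn ℝ ∞ u I) (hv : ContDiffOn ℝ ∞ v J)
    (h : ∀ x ∈ I, ∀ y ∈ J, minimalOperator u v x y = 0) :
    (∃ u₀ a b, (∀ x ∈ I, u x = u₀) ∧ (0 ∈ J → a = 0) ∧ ∀ y ∈ J, v y = a / y + b) ∨
      ∃ a b c c₁, (∀ y ∈ J, v y = a * y + b) ∧ ∀ x ∈ I, u x = profile a b c c₁ x := by
  obtain ⟨du, hu'⟩ := (contDiffOn_infty_iff_deriv_of_isOpen hI).1 hu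
  obtain ⟨dv, hv'⟩ := (contDiffOn_infty_iff_deriv_of_isOpen hJ).1 hv
  replace hu' := hu'.differentiableOn (by simp)
  replace hv' := hv'.differentiableOn (by simp)
  by_cases hcurved : ∃ y ∈ J, deriv (deriv v) y ≠ 0
  · obtain ⟨u₀, hu₀⟩ := exists_eq_const_of_deriv_deriv_ne_zero hI hIc hJ hu hv hcurved h
    obtain ⟨x, hx⟩ := hIne
    have hp : Set.EqOn (deriv u) (fun _ => 0) I := by simpa using Set.EqOn.deriv hu₀ hI
    have hP : deriv (deriv u) x = 0 := by simpa using hp.deriv hI hx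
    obtain ⟨a, b, ha, hab⟩ := exists_eq_div_add_of_ode hJ hJc dv hv' fun y hy => by
      simpa [minimalOperator, hp hx, hP] using h x hx y hy
    exact .inl ⟨u₀, a, b, hu₀, ha, hab⟩
  · push Not at hcurved
    obtain ⟨a, b, hab⟩ := exists_eq_mul_add_of_deriv_deriv_eq_zero hJ hJc dv hv' hcurved
    obtain ⟨y, hy⟩ := hJne
    obtain ⟨c, c₁, hc⟩ := exists_eq_profile_of_ode (a := a) (b := b) hI hIc du hu' fun x hx =>
      (sub_eq_zero.1 ((minimalOperator_of_affine hJ hab hy).symm.trans (h x hx y hy))).symm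
    exact .inr ⟨a, b, c, c₁, hab, hc⟩

end Classification

end Nil3

theorem theorem6 (I J : Set ℝ)
    (hIopen : IsOpen I) (hIconn : I.OrdConnected) (hIne : I.Nonempty)
    (hJopen : IsOpen J) (hJconn : J.OrdConnected) (hJne : J.Nonempty)
    (u v : ℝ → ℝ) (hu : ContDiffOn ℝ ∞ u I) (hv : ContDiffOn ℝ ∞ v J) :
    (∀ x y : ℝ, Nil3.type6Surface u v (x, y) = ![y, x + v y, u x + x * y / 2]) ∧
    (Nil3.IsMinimal (Nil3.type6Surface u v) (I ×ˢ J) ↔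
      (∃ u₀ a b : ℝ, (∀ x ∈ I, u x = u₀) ∧
        ((0 : ℝ) ∈ J → a = 0) ∧ (∀ y ∈ J, v y = a / y + b)) ∨
      (∃ a b c c₁ : ℝ, (∀ y ∈ J, v y = a * y + b) ∧
        (∀ x ∈ I, u x =
          (a * x ^ 2 + a * b * x + c) / (2 * (1 + a ^ 2))
          + c₁ * (x / 2 + b / 4) * Real.sqrt (4 * (1 + a ^ 2) + (2 * x + b) ^ 2)
          + c₁ * (1 + a ^ 2) *
            Real.log (2 * x + b + Real.sqrt (4 * (1 + a ^ 2) + (2 * x + b) ^ 2))))) := by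
  refine ⟨Nil3.type6Surface_apply u v, ?_⟩
  rw [Nil3.isMinimal_type6Surface_iff hIopen hJopen hu hv]
  constructor
  · exact Nil3.eq_const_or_eq_profile_of_minimalOperator_eq_zero hIopen hIconn hIne hJopen hJconn
      hJne hu hv
  · rintro (⟨u₀, a, b, hu₀, ha, hv₀⟩ | ⟨a, b, c, c₁, hv₀, hu₀⟩) x hx y hy
    · exact Nil3.minimalOperator_eq_zero_of_const hIopen hJopen hu₀ ha hv₀ hx hy
    · exact Nil3.minimalOperator_eq_zero_of_profile hIopen hJopen hv₀ hu₀ hx hy
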